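/- Let $\mathcal X$ be a measurable space, let $k\colon\mathcal X\times\mathcal X\to\mathbb R$ be a symmetric positive definite kernel (all finite quadratic forms $\sum_{i,j}c_ic_jk(x_i,x_j)$ are nonnegative) which is measurable and bounded (for instance a bounded continuous kernel on a second countable topological space with its Borel $\sigma$-algebra), and let $(\mathcal H_k,\|\cdot\|_k)$ be its reproducing kernel Hilbert space. Let $\rho$ be a probability measure on $\mathcal X\times\mathbb R$ with marginal $P$ on $\mathcal X$, let $(X,f)$ have law $\rho$ with $\mathbb E f^2<\infty$, let $f_0(x)=\mathbb E(f\mid X=x)$, and let $$Kw(x)=\int_{\mathcal X}k(x,y)\,w(y)\,P(dy).$$ For independent samples $(X_1,f_1),\dots,(X_n,f_n)$ with law $\rho$ and for $\lambda>0$ let $$\hat f_n(\cdot)=\frac1n\sum_{i=1}^n \hat w_i\,k(\cdot,X_i),\qquad \hat w=\Big(\lambda+\frac1n\big(k(X_i,X_j)\big)_{i,j=1}^n\Big)^{-1}(f_1,\dots,f_n)^\top .$$ Suppose that $f_0=Kw_0$ $P$-almost everywhere for some $w_0\in\mathcal H_k$. Then $Kw_0\in\mathcal H_k$, so that $f_0$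 (taken to be its version $Kw_0$) lies in $\mathcal H_k$. There are constants $C_0,C_1,C_2$, independent of $n$ and $\lambda$, such that for all $n\ge1$ and $\lambda>0$ $$\mathbb E\|f_0-\hat f_n\|_k^2\le 2C_0\lambda^2+\frac{4C_1}{\lambda^2 n}+\frac{C_2}{\lambda^3 n}.$$ Likewise there are constants $C_0,C_1,C_2$ (possibly different ones), independent of $n$ and $\lambda$, such that for all $n\ge1$ and $\lambda>0$, with $\|g\|_2^2=\int_{\mathcal X} g^2\,dP$, $$\mathbb E\|f_0-\hat f_n\|_2^2\le C_0\lambda^2+\frac{4C_1}{\lambda^2 n}+\frac{C_2}{\lambda^3 n}.$$ -/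

import Mathlib

open MeasureTheory ProbabilityTheory

universe u v

noncomputable section

/-- A symmetric positive definite kernel `k : 𝒳 × 𝒳 → ℝ`. As usual for reproducing kernels,
positive definite means that all finite quadratic forms are nonnegative. -/
structure PosDefKernel (𝒳 : Type*) where
  toFun : 𝒳 → 𝒳 → ℝ
  symm' : ∀ x y, toFun x y = toFun y x
  nonneg' : ∀ (s : Finset 𝒳) (c : 𝒳 → ℝ), 0 ≤ ∑ x ∈ s, ∑ y ∈ s, c x * c y * toFun x y

namespace PosDefKernel

variable {𝒳 : Type*}

instance : CoeFun (PosDefKernel 𝒳) (fun _ => 𝒳 → 𝒳 → ℝ) := ⟨toFun⟩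

/-- The kernel with its real values regarded as linear maps `ℝ → ℝ`, the format in which Mathlib
takes the kernel of a reproducing kernel Hilbert space. -/
def matrix (k : PosDefKernel 𝒳) : Matrix 𝒳 𝒳 (ℝ →L[ℝ] ℝ) :=
  Matrix.of fun x y => k x y • ContinuousLinearMap.id ℝ ℝ

theorem matrix_apply (k : PosDefKernel 𝒳) (x y : 𝒳) (v : ℝ) : k.matrix x y v = k x y * v := rfl

instance (k : PosDefKernel 𝒳) : Fact k.matrix.PosSemidef := by
  have tfae := RKHS.posSemidef_tfae (K := k.matrix)
  have key : k.matrix.PosSemidef ↔ (k.matrix.IsHermitian ∧ ∀ c : 𝒳 →₀ ℝ,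
      0 ≤ RCLike.re (c.sum fun x v => c.sum fun y w => inner ℝ (k.matrix y x v) w)) :=
    tfae.out 0 2
  refine ⟨key.mpr ⟨?_, fun c => ?_⟩⟩
  · ext x y
    simp only [Matrix.conjTranspose_apply, ContinuousLinearMap.star_eq_adjoint]
    refine ext_inner_right ℝ fun w => ?_
    rw [ContinuousLinearMap.adjoint_inner_left]
    simp [matrix_apply, k.symm' x y, mul_comm]
  · have h := k.nonneg' c.support c
    refine h.trans_eq ?_
    simp only [Finsupp.sum, RCLike.re_to_real]
    refine Finset.sum_congr rfl fun x _ => Finset.sum_congr rfl fun y _ => ?_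
    simp only [matrix_apply, RCLike.inner_apply, conj_trivial]
    rw [k.symm' x y]
    ring

/-- The reproducing kernel Hilbert space `H_k`: the completion of the span of the functions
`k(·, x)` for the inner product with `⟨k(·, x), k(·, y)⟩ = k(x, y)`. Its elements are coerced to
functions `𝒳 → ℝ` by point evaluation. -/
abbrev H (k : PosDefKernel 𝒳) := RKHS.OfKernel k.matrix

/-- The function `k(·, x)` as an element of `H_k`. -/
def sec (k : PosDefKernel 𝒳) (x : 𝒳) : k.H := RKHS.kerFun k.H x (1 : ℝ)

theorem sec_apply (k : PosDefKernel 𝒳) (x y : 𝒳) : k.sec x y = k y x := by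
  rw [sec, RKHS.kerFun_apply, RKHS.OfKernel.kernel_ofKernel, matrix_apply, mul_one]

theorem inner_sec (k : PosDefKernel 𝒳) (x : 𝒳) (h : k.H) : inner ℝ (k.sec x) h = h x := by
  rw [sec, RKHS.kerFun_inner]
  simp

/-- The integral operator `(K w)(x) = ∫ k(x, y) w(y) P(dy)`. -/
def integralOp [MeasurableSpace 𝒳] (k : PosDefKernel 𝒳) (P : Measure 𝒳) (w : 𝒳 → ℝ) : 𝒳 → ℝ :=
  fun x => ∫ y, k x y * w y ∂P

/-- The Gram matrix `(k(x_i, x_j))_{ij}`. -/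
def gram (k : PosDefKernel 𝒳) {n : ℕ} (x : Fin n → 𝒳) : Matrix (Fin n) (Fin n) ℝ :=
  Matrix.of fun i j => k (x i) (x j)

/-- The weights `ŵ = (λ + K / n)⁻¹ f` of the estimator, for data `(x_i, f_i)`. -/
def weights (k : PosDefKernel 𝒳) (lam : ℝ) {n : ℕ} (x : Fin n → 𝒳) (f : Fin n → ℝ) : Fin n → ℝ :=
  (lam • (1 : Matrix (Fin n) (Fin n) ℝ) + (1 / (n : ℝ)) • k.gram x)⁻¹.mulVec f

theorem gram_posSemidef (k : PosDefKernel 𝒳) {n : ℕ} (x : Fin n → 𝒳) :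
    (k.gram x).PosSemidef := by
  have h : k.gram x = Matrix.gram ℝ fun i => k.sec (x i) := by
    ext i j
    rw [Matrix.gram_apply, inner_sec, sec_apply, gram, Matrix.of_apply]
  rw [h]
  exact Matrix.posSemidef_gram ℝ _

/-- For `λ > 0` the weights solve the linear system `λ ŵᵢ + (1/n) ∑ⱼ k(xᵢ, xⱼ) ŵⱼ = fᵢ`. -/
theorem weights_spec (k : PosDefKernel 𝒳) {lam : ℝ} (hlam : 0 < lam) {n : ℕ} (x : Fin n → 𝒳)
    (f : Fin n → ℝ) (i : Fin n) :
    lam * k.weights lam x f i + 1 / (n : ℝ) * ∑ j, k (x i) (x j) * k.weights lam x f j = f i := by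
  set A : Matrix (Fin n) (Fin n) ℝ :=
    lam • (1 : Matrix (Fin n) (Fin n) ℝ) + (1 / (n : ℝ)) • k.gram x with hA
  have hpd : A.PosDef := (Matrix.PosDef.one.smul hlam).add_posSemidef
    ((k.gram_posSemidef x).smul (by positivity))
  have hdet : IsUnit A.det := hpd.det_pos.ne'.isUnit
  have h : A.mulVec (k.weights lam x f) = f := by
    rw [weights, ← hA, Matrix.mulVec_mulVec, Matrix.mul_nonsing_inv _ hdet, Matrix.one_mulVec]
  have hi := congrFun h i
  rw [hA, Matrix.add_mulVec, Matrix.smul_mulVec, Matrix.smul_mulVec, Matrix.one_mulVec] at hi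
  simpa [Matrix.mulVec, dotProduct, gram] using hi

/-- The kernel ridge regression estimator `f̂ₙ = (1/n) ∑ᵢ ŵᵢ k(·, xᵢ)` as an element of `H_k`. -/
def estimator (k : PosDefKernel 𝒳) (lam : ℝ) {n : ℕ} (x : Fin n → 𝒳) (f : Fin n → ℝ) : k.H :=
  (1 / (n : ℝ)) • ∑ i, k.weights lam x f i • k.sec (x i)

end PosDefKernel

/-- `f₀` is a version of the regression function `x ↦ E(f | X = x)` of a pair `(X, f)` with law
`ρ`. -/
def IsRegressionFunction {𝒳 : Type*} [m : MeasurableSpace 𝒳] (ρ : Measure (𝒳 × ℝ))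
    (f₀ : 𝒳 → ℝ) : Prop :=
  Measurable f₀ ∧ (fun p : 𝒳 × ℝ => f₀ p.1) =ᵐ[ρ] ρ[Prod.snd | m.comap Prod.fst]

/-- `(X₁, f₁), …, (Xₙ, fₙ)` are independent with law `ρ`. -/
def IsSample {𝒳 Ω : Type*} [MeasurableSpace 𝒳] [MeasurableSpace Ω] (ρ : Measure (𝒳 × ℝ))
    (μ : Measure Ω) {n : ℕ} (X : Fin n → Ω → 𝒳) (f : Fin n → Ω → ℝ) : Prop :=
  iIndepFun (fun i ω => (X i ω, f i ω)) μ ∧ ∀ i, HasLaw (fun ω => (X i ω, f i ω)) ρ μ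

end

/-! Let `T h = (1/n) ∑ h(xᵢ) k(·, xᵢ)` be the empirical version of `K` on `H_k`. The linear system
for the weights says that the estimator `e` solves `(λ + T) e = T g + U`, where `g = K w₀` and `U`
is the average of the terms `(fᵢ - g(xᵢ)) k(·, xᵢ)`. Since `T ≥ 0`, the inverse of `λ + T` has norm
at most `1/λ`. Comparing `e` with `g - λ w₀` gives the deterministic bound `‖g - e‖ ≤ ‖U‖/λ + ‖g - T
w₀‖ + 2λ‖w₀‖` (`norm_sub_estimator_le`).

Both `U` and `g - T w₀` are averages of independent centered variables in `H_k`, so their mean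
square norms are constants over `n` (`integral_norm_sq_average`). This yields the `H_k` bound even
without the `λ⁻³` term. The `L²` bound follows from `h(x)² ≤ κ ‖h‖²`.

Centering and measurability are expressed through real inner products only, so no Bochner integral
in `H_k` is needed. -/

/-! ### Averages of independent centered variables in an inner product space. -/

section Variance

variable {𝒵 Ω E : Type*} [MeasurableSpace 𝒵] [MeasurableSpace Ω]
  [NormedAddCommGroup E] [InnerProductSpace ℝ E]

/-- The inner products of a weakly measurable, square integrable map are integrable along any
pair of random variables with the same law. -/
theorem integrable_inner_comp_hasLaw {ρ : Measure 𝒵} {μ : Measure Ω} {ψ : 𝒵 → E}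
    (hmeas : Measurable fun p : 𝒵 × 𝒵 => inner ℝ (ψ p.1) (ψ p.2))
    (hint : Integrable (fun z => ‖ψ z‖ ^ 2) ρ) {Y Z : Ω → 𝒵}
    (hY : HasLaw Y ρ μ) (hZ : HasLaw Z ρ μ) :
    Integrable (fun ω => inner ℝ (ψ (Y ω)) (ψ (Z ω))) μ := by
  have sq : ∀ {W : Ω → 𝒵}, HasLaw W ρ μ → Integrable (fun ω => ‖ψ (W ω)‖ ^ 2) μ := by
    intro W hW
    have := hint
    rw [← hW.map_eq] at this
    exact this.comp_aemeasurable hW.aemeasurable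
  refine ((sq hY).add (sq hZ)).mono'
    (hmeas.comp_aemeasurable (hY.aemeasurable.prodMk hZ.aemeasurable)).aestronglyMeasurable
    (ae_of_all _ fun ω => ?_)
  have h := abs_real_inner_le_norm (ψ (Y ω)) (ψ (Z ω))
  simp only [Pi.add_apply, Real.norm_eq_abs]
  nlinarith [sq_nonneg (‖ψ (Y ω)‖ - ‖ψ (Z ω)‖), sq_nonneg (‖ψ (Y ω)‖ + ‖ψ (Z ω)‖)]

/-- The mean square norm of an average of independent, weakly centered Hilbert space valued
random variables with a common law. -/
theorem integral_norm_sq_average {ρ : Measure 𝒵} [IsProbabilityMeasure ρ] {μ : Measure Ω}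
    [IsProbabilityMeasure μ] {ψ : 𝒵 → E}
    (hmeas : Measurable fun p : 𝒵 × 𝒵 => inner ℝ (ψ p.1) (ψ p.2))
    (hint : Integrable (fun z => ‖ψ z‖ ^ 2) ρ)
    (hcent : ∀ z, ∫ z', inner ℝ (ψ z) (ψ z') ∂ρ = 0)
    {n : ℕ} (hn : 0 < n) {Z : Fin n → Ω → 𝒵} (hindep : iIndepFun Z μ)
    (hlaw : ∀ i, HasLaw (Z i) ρ μ) :
    Integrable (fun ω => ‖(1 / (n : ℝ)) • ∑ i, ψ (Z i ω)‖ ^ 2) μ ∧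
      ∫ ω, ‖(1 / (n : ℝ)) • ∑ i, ψ (Z i ω)‖ ^ 2 ∂μ = (∫ z, ‖ψ z‖ ^ 2 ∂ρ) / n := by
  have hn' : (n : ℝ) ≠ 0 := by positivity
  have expand : ∀ ω, ‖(1 / (n : ℝ)) • ∑ i, ψ (Z i ω)‖ ^ 2 =
      (1 / (n : ℝ)) ^ 2 * ∑ i, ∑ j, inner ℝ (ψ (Z i ω)) (ψ (Z j ω)) := by
    intro ω
    rw [norm_smul, mul_pow, Real.norm_eq_abs, sq_abs, ← real_inner_self_eq_norm_sq, sum_inner]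
    simp_rw [inner_sum]
  have hI : ∀ i j, Integrable (fun ω => inner ℝ (ψ (Z i ω)) (ψ (Z j ω))) μ := fun i j =>
    integrable_inner_comp_hasLaw hmeas hint (hlaw i) (hlaw j)
  -- By independence the pair has law `ρ.prod ρ`; integrating the second variable with the first one
  -- fixed gives zero by `hcent`.
  have hoff : ∀ i j, i ≠ j → ∫ ω, inner ℝ (ψ (Z i ω)) (ψ (Z j ω)) ∂μ = 0 := by
    intro i j hij
    have hpair : HasLaw (fun ω => (Z i ω, Z j ω)) (ρ.prod ρ) μ :=
      (indepFun_iff_hasLaw_prodMk_prod (hlaw i) (hlaw j)).1 (hindep.indepFun hij)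
    have h := hpair.integral_comp (f := fun p => inner ℝ (ψ p.1) (ψ p.2))
      hmeas.aestronglyMeasurable
    have hprod : Integrable (fun p : 𝒵 × 𝒵 => inner ℝ (ψ p.1) (ψ p.2)) (ρ.prod ρ) := by
      rw [← hpair.map_eq, integrable_map_measure hmeas.aestronglyMeasurable hpair.aemeasurable]
      exact hI i j
    rw [integral_prod _ hprod] at h
    simp only [hcent, integral_zero] at h
    exact h
  have hdiag : ∀ i, ∫ ω, inner ℝ (ψ (Z i ω)) (ψ (Z i ω)) ∂μ = ∫ z, ‖ψ z‖ ^ 2 ∂ρ := by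
    intro i
    simp_rw [real_inner_self_eq_norm_sq]
    exact (hlaw i).integral_comp (f := fun z => ‖ψ z‖ ^ 2) hint.aestronglyMeasurable
  simp_rw [expand]
  refine ⟨(integrable_finsetSum _ fun i _ => integrable_finsetSum _ fun j _ => hI i j).const_mul _,
    ?_⟩
  rw [integral_const_mul, integral_finsetSum _ fun i _ => integrable_finsetSum _ fun j _ => hI i j]
  have : ∀ i, ∫ ω, ∑ j, inner ℝ (ψ (Z i ω)) (ψ (Z j ω)) ∂μ = ∫ z, ‖ψ z‖ ^ 2 ∂ρ := by
    intro i
    rw [integral_finsetSum _ fun j _ => hI i j,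
      Finset.sum_eq_single i (fun j _ hj => hoff i j hj.symm) (by simp), hdiag]
  simp only [this, Finset.sum_const, Finset.card_univ, Fintype.card_fin, nsmul_eq_mul]
  field_simp

end Variance

/-! ### Measurability of matrix inverses. -/

/-- Determinants of matrices with measurable entries are measurable. -/
theorem measurable_det_of_entries {α ι : Type*} [MeasurableSpace α] [Fintype ι] [DecidableEq ι]
    {A : α → Matrix ι ι ℝ} (hA : ∀ i j, Measurable fun a => A a i j) :
    Measurable fun a => (A a).det := by
  simp only [Matrix.det_apply]
  refine Finset.measurable_fun_sum _ fun σ _ => ?_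
  exact (Finset.measurable_fun_prod _ fun i _ => hA _ _).const_smul _

/-- Inverses of matrices with measurable entries have measurable entries. -/
theorem measurable_inv_entries {α ι : Type*} [MeasurableSpace α] [Fintype ι] [DecidableEq ι]
    {A : α → Matrix ι ι ℝ} (hA : ∀ i j, Measurable fun a => A a i j) (i j : ι) :
    Measurable fun a => (A a)⁻¹ i j := by
  -- Cramer's rule makes each entry a quotient of determinants. Singular matrices do no harm, since
  -- `0⁻¹ = 0` in `ℝ`.
  simp only [Matrix.inv_def, Matrix.smul_apply, Ring.inverse_eq_inv', smul_eq_mul,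
    Matrix.adjugate_apply]
  refine (measurable_det_of_entries hA).inv.mul (measurable_det_of_entries fun p q => ?_)
  by_cases h : p = j
  · subst h
    simp [Matrix.updateRow_self]
  · simpa [Matrix.updateRow_ne h] using hA p q

/-! ### Evaluation in `H_k` and deterministic stability. -/

namespace PosDefKernel

variable {𝒳 : Type*} (k : PosDefKernel 𝒳)

theorem inner_sec_sec (x y : 𝒳) : inner ℝ (k.sec x) (k.sec y) = k x y := by
  rw [inner_sec, sec_apply]

theorem norm_sec_sq (x : 𝒳) : ‖k.sec x‖ ^ 2 = k x x := by
  rw [← real_inner_self_eq_norm_sq, inner_sec_sec]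

/-- Point evaluations are bounded by the norm when the kernel is bounded on the diagonal. -/
theorem apply_sq_le {κ : ℝ} (hκ : ∀ x, k x x ≤ κ) (h : k.H) (x : 𝒳) :
    h x ^ 2 ≤ κ * ‖h‖ ^ 2 := by
  rw [← inner_sec, ← sq_abs]
  calc |inner ℝ (k.sec x) h| ^ 2 ≤ (‖k.sec x‖ * ‖h‖) ^ 2 := by
        gcongr
        exact abs_real_inner_le_norm _ _
    _ = k x x * ‖h‖ ^ 2 := by rw [mul_pow, norm_sec_sq]
    _ ≤ κ * ‖h‖ ^ 2 := by gcongr; exact hκ x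

theorem abs_apply_le {κ : ℝ} (hκ : ∀ x, k x x ≤ κ) (h : k.H) (x : 𝒳) :
    |h x| ≤ √κ * ‖h‖ := by
  refine abs_le_of_sq_le_sq ?_ (by positivity)
  rw [mul_pow, Real.sq_sqrt]
  · exact k.apply_sq_le hκ h x
  · exact (sq_nonneg _).trans ((k.norm_sec_sq x).trans_le (hκ x))

theorem sum_smul_sec_apply {ι : Type*} (s : Finset ι) (c : ι → ℝ) (x : ι → 𝒳) (y : 𝒳) :
    (∑ i ∈ s, c i • k.sec (x i) : k.H) y = ∑ i ∈ s, c i * k y (x i) := by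
  rw [← inner_sec, inner_sum]
  simp [inner_smul_right, inner_sec_sec]

theorem estimator_apply (lam : ℝ) {n : ℕ} (x : Fin n → 𝒳) (f : Fin n → ℝ) (y : 𝒳) :
    k.estimator lam x f y = 1 / (n : ℝ) * ∑ i, k.weights lam x f i * k y (x i) := by
  rw [estimator, RKHS.coe_smul, Pi.smul_apply, sum_smul_sec_apply, smul_eq_mul]

theorem inner_estimator (lam : ℝ) {n : ℕ} (x : Fin n → 𝒳) (f : Fin n → ℝ) (h : k.H) :
    inner ℝ h (k.estimator lam x f) = 1 / (n : ℝ) * ∑ i, k.weights lam x f i * h (x i) := by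
  rw [real_inner_comm, estimator]
  simp [inner_smul_left, sum_inner, inner_sec]

/-- Stability of kernel ridge regression: the error at a target `g` in terms of the sampling noise
`u` and of the deviation `v` of `g` from the empirical integral operator applied to `w`. -/
theorem norm_sub_estimator_le {lam : ℝ} (hlam : 0 < lam) {n : ℕ} (x : Fin n → 𝒳) (f : Fin n → ℝ)
    (g w : k.H) :
    ‖g - k.estimator lam x f‖ ≤
      ‖(1 / (n : ℝ)) • ∑ i, (f i - g (x i)) • k.sec (x i)‖ / lam +
      ‖g - (1 / (n : ℝ)) • ∑ i, w (x i) • k.sec (x i)‖ + 2 * lam * ‖w‖ := by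
  let T : k.H → k.H := fun h => (1 / (n : ℝ)) • ∑ i, h (x i) • k.sec (x i)
  have hT_add : ∀ a b, T (a + b) = T a + T b := fun a b => by
    simp [T, add_smul, Finset.sum_add_distrib, smul_add]
  have hT_sub : ∀ a b, T (a - b) = T a - T b := fun a b => by
    simp [T, sub_smul, Finset.sum_sub_distrib, smul_sub]
  have hT_smul : ∀ (c : ℝ) a, T (c • a) = c • T a := fun c a => by
    simp only [T, RKHS.coe_smul, Pi.smul_apply, smul_eq_mul, mul_smul, ← Finset.smul_sum]
    rw [smul_comm]
  have hT_nonneg : ∀ a, 0 ≤ inner ℝ (T a) a := fun a => by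
    simp only [T, inner_smul_left, sum_inner, inner_sec]
    refine mul_nonneg (by simp) (Finset.sum_nonneg fun i _ => ?_)
    simpa using mul_self_nonneg (a (x i))
  set e := k.estimator lam x f with he
  -- The coefficient of `k.sec (x i)` on the left is `lam` times the weight plus `e (x i)`, which
  -- `weights_spec` evaluates to `f i`.
  have hnormal : lam • e + T e = (1 / (n : ℝ)) • ∑ i, f i • k.sec (x i) := by
    have hval : ∀ i, e (x i) = 1 / (n : ℝ) * ∑ j, k (x i) (x j) * k.weights lam x f j := by
      intro i
      rw [he, estimator, RKHS.coe_smul, Pi.smul_apply, sum_smul_sec_apply, smul_eq_mul]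
      simp_rw [mul_comm]
    have : lam • e = (1 / (n : ℝ)) • ∑ i, (lam * k.weights lam x f i) • k.sec (x i) := by
      rw [he, estimator, smul_comm, Finset.smul_sum]
      simp_rw [smul_smul]
    rw [this, ← smul_add, ← Finset.sum_add_distrib]
    congr 1
    refine Finset.sum_congr rfl fun i _ => ?_
    rw [← add_smul, hval, k.weights_spec hlam]
  set U := (1 / (n : ℝ)) • ∑ i, (f i - g (x i)) • k.sec (x i) with hU
  have hUeq : U = lam • e + T e - T g := by
    rw [hnormal, hU]
    simp [T, sub_smul, Finset.sum_sub_distrib, smul_sub]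
  -- The shift by `lam • w` removes the leading bias: `e - g` alone has residual `U - lam • g`,
  -- which after division by `lam` is not small. With the shift, `g` is replaced by `g - T w` and a
  -- term of order `lam ^ 2`.
  set d : k.H := e - g + lam • w with hd
  have hres : lam • d + T d = U - lam • (g - T w) + lam • lam • w := by
    rw [hUeq, hd, hT_add, hT_sub, hT_smul]
    module
  have hdle : lam * ‖d‖ ≤ ‖U‖ + lam * ‖g - T w‖ + lam * (lam * ‖w‖) := by
    -- Coercivity: pair with `d`, drop `⟨T d, d⟩ ≥ 0`, and cancel one factor `‖d‖`.
    have hle : lam * ‖d‖ ≤ ‖lam • d + T d‖ := by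
      by_cases h0 : ‖d‖ = 0
      · simp only [h0, mul_zero]; positivity
      have h1 : lam * ‖d‖ ^ 2 ≤ inner ℝ (lam • d + T d) d := by
        rw [inner_add_left, inner_smul_left, real_inner_self_eq_norm_sq]
        simpa using hT_nonneg d
      have h2 := h1.trans (real_inner_le_norm (lam • d + T d) d)
      have h3 : 0 < ‖d‖ := lt_of_le_of_ne (norm_nonneg _) (Ne.symm h0)
      nlinarith
    rw [hres] at hle
    refine hle.trans ((norm_add_le _ _).trans ?_)
    refine add_le_add ((norm_sub_le _ _).trans_eq ?_) (le_of_eq ?_)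
    · rw [norm_smul lam, Real.norm_of_nonneg hlam.le]
    · rw [norm_smul, norm_smul, Real.norm_of_nonneg hlam.le]
  have hge : ‖g - e‖ ≤ ‖d‖ + lam * ‖w‖ := by
    have : g - e = lam • w - d := by rw [hd]; abel
    rw [this]
    refine (norm_sub_le _ _).trans_eq ?_
    rw [norm_smul, Real.norm_of_nonneg hlam.le, add_comm]
  have : ‖d‖ ≤ ‖U‖ / lam + ‖g - T w‖ + lam * ‖w‖ := by
    rw [← mul_le_mul_iff_right₀ hlam]
    refine hdle.trans_eq ?_
    field_simp
  change ‖g - e‖ ≤ ‖U‖ / lam + ‖g - T w‖ + 2 * lam * ‖w‖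
  linarith

/-! ### Measurability and the integral operator on `H_k`. -/

variable [MeasurableSpace 𝒳]

/-- All elements of the reproducing kernel Hilbert space of a measurable kernel are measurable. -/
theorem measurable_coe (hk : Measurable fun p : 𝒳 × 𝒳 => k p.1 p.2) (h : k.H) :
    Measurable (h : 𝒳 → ℝ) := by
  have hspan : ∀ g ∈ Submodule.span ℝ {RKHS.kerFun k.H x v | (x) (v)}, Measurable (g : 𝒳 → ℝ) := by
    intro g hg
    induction hg using Submodule.span_induction with
    | mem g hg =>
      obtain ⟨x, v, rfl⟩ := hg
      have : (RKHS.kerFun k.H x v : 𝒳 → ℝ) = fun y => k y x * v := by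
        ext y
        rw [RKHS.kerFun_apply, RKHS.OfKernel.kernel_ofKernel, matrix_apply]
      rw [this]
      exact (hk.comp (measurable_id.prodMk measurable_const)).mul_const v
    | zero => rw [RKHS.coe_zero]; exact measurable_const
    | add a b _ _ ha hb => rw [RKHS.coe_add]; exact ha.add hb
    | smul c a _ ha => rw [RKHS.coe_smul]; exact ha.const_smul c
  -- Convergence in `H_k` implies pointwise convergence, so measurability passes from the dense span
  -- to all of `H_k`.
  have hmem : h ∈ (Submodule.span ℝ {RKHS.kerFun k.H x v | (x) (v)}).topologicalClosure := by
    rw [RKHS.kerFun_dense]; trivial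
  obtain ⟨s, hs, hlim⟩ := mem_closure_iff_seq_limit.1 hmem
  refine measurable_of_tendsto_metrizable (fun n => hspan _ (hs n)) ?_
  exact tendsto_pi_nhds.2 fun x => ((RKHS.continuous_eval x).tendsto h).comp hlim

/-- The Riesz representer of `h ↦ ∫ h w dP`, an element of `H_k` that equals `K w` pointwise. -/
theorem exists_integralOp_eq (hk : Measurable fun p : 𝒳 × 𝒳 => k p.1 p.2) {κ : ℝ}
    (hκ : ∀ x, k x x ≤ κ) (P : Measure 𝒳) [IsProbabilityMeasure P] (w : k.H) :
    ∃ g : k.H, (∀ h : k.H, inner ℝ g h = ∫ y, h y * w y ∂P) ∧ ∀ x, g x = k.integralOp P w x := by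
  have bound : ∀ (h : k.H) (y : 𝒳), ‖h y * w y‖ ≤ √κ * ‖w‖ * √κ * ‖h‖ := by
    intro h y
    rw [norm_mul, Real.norm_eq_abs, Real.norm_eq_abs]
    calc |h y| * |w y| ≤ (√κ * ‖h‖) * (√κ * ‖w‖) := by
          gcongr
          · exact k.abs_apply_le hκ h y
          · exact k.abs_apply_le hκ w y
      _ = _ := by ring
  have hint : ∀ h : k.H, Integrable (fun y => h y * w y) P := fun h =>
    Integrable.of_bound ((k.measurable_coe hk h).mul (k.measurable_coe hk w)).aestronglyMeasurable
      _ (ae_of_all _ (bound h))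
  let L : k.H →ₗ[ℝ] ℝ :=
    { toFun := fun h => ∫ y, h y * w y ∂P
      map_add' := fun a b => by
        simp only [RKHS.coe_add, Pi.add_apply, add_mul]
        exact integral_add (hint a) (hint b)
      map_smul' := fun c a => by
        simp only [RKHS.coe_smul, Pi.smul_apply, smul_eq_mul, mul_assoc, RingHom.id_apply]
        exact integral_const_mul _ _ }
  let L' : k.H →L[ℝ] ℝ := L.mkContinuous (√κ * ‖w‖ * √κ) fun h => by
    have := norm_integral_le_of_norm_le_const (μ := P) (ae_of_all P (bound h))
    simpa [L] using this
  have hg : ∀ h : k.H, inner ℝ ((InnerProductSpace.toDual ℝ k.H).symm L') h =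
      ∫ y, h y * w y ∂P := fun h => by
    rw [InnerProductSpace.toDual_symm_apply]; rfl
  refine ⟨_, hg, fun x => ?_⟩
  rw [← inner_sec, real_inner_comm, hg, integralOp]
  simp_rw [sec_apply]
  exact integral_congr_ae (ae_of_all _ fun y => by simp only [k.symm' x y])

theorem measurable_weights (hk : Measurable fun p : 𝒳 × 𝒳 => k p.1 p.2) (lam : ℝ) {n : ℕ}
    (i : Fin n) : Measurable fun d : Fin n → 𝒳 × ℝ =>
      k.weights lam (fun i => (d i).1) (fun i => (d i).2) i := by
  simp only [weights, Matrix.mulVec, dotProduct]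
  refine Finset.measurable_fun_sum _ fun j _ => ?_
  refine (measurable_inv_entries (fun p q => ?_) i j).mul (measurable_pi_apply j).snd
  simp only [Matrix.add_apply, Matrix.smul_apply, gram, Matrix.of_apply, smul_eq_mul]
  exact ((hk.comp ((measurable_pi_apply p).fst.prodMk (measurable_pi_apply q).fst)).const_mul
    _).const_add _

/-- Joint measurability serves twice: for evaluation at the sample points themselves, and for
integration over the evaluation point. -/
theorem measurable_estimator_uncurry (hk : Measurable fun p : 𝒳 × 𝒳 => k p.1 p.2) (lam : ℝ)
    (n : ℕ) : Measurable fun p : (Fin n → 𝒳 × ℝ) × 𝒳 =>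
      k.estimator lam (fun i => (p.1 i).1) (fun i => (p.1 i).2) p.2 := by
  simp only [estimator_apply]
  refine (Finset.measurable_fun_sum _ fun i _ => ?_).const_mul _
  refine ((k.measurable_weights hk lam i).comp measurable_fst).mul ?_
  exact hk.comp (measurable_snd.prodMk (measurable_fst.eval (a := i)).fst)

/-- Expanding the square leaves finite sums of weights times point values, so measurability of
`k.sec` as a map into `H_k` is not needed. -/
theorem measurable_norm_sub_estimator_sq (hk : Measurable fun p : 𝒳 × 𝒳 => k p.1 p.2) (lam : ℝ)
    (n : ℕ) (g : k.H) : Measurable fun d : Fin n → 𝒳 × ℝ =>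
      ‖g - k.estimator lam (fun i => (d i).1) (fun i => (d i).2)‖ ^ 2 := by
  have hw := fun i => k.measurable_weights hk lam (n := n) i
  have hx := fun i => (measurable_pi_apply (X := fun _ : Fin n => 𝒳 × ℝ) i).fst
  simp only [norm_sub_sq_real]
  simp only [← real_inner_self_eq_norm_sq (k.estimator _ _ _), inner_estimator]
  refine ((Measurable.const_mul ?_ _).const_sub _).add ?_
  · exact (Finset.measurable_fun_sum _ fun i _ =>
      (hw i).mul ((k.measurable_coe hk g).comp (hx i))).const_mul _
  · exact (Finset.measurable_fun_sum _ fun i _ =>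
      (hw i).mul ((k.measurable_estimator_uncurry hk lam n).comp
        (measurable_id.prodMk (hx i)))).const_mul _

/-- Elements of the reproducing kernel Hilbert space of a bounded kernel are square integrable. -/
theorem memLp_coe (hk : Measurable fun p : 𝒳 × 𝒳 => k p.1 p.2) {κ : ℝ} (hκ : ∀ x, k x x ≤ κ)
    (P : Measure 𝒳) [IsProbabilityMeasure P] (h : k.H) : MemLp (h : 𝒳 → ℝ) 2 P :=
  MemLp.of_bound (k.measurable_coe hk h).aestronglyMeasurable _
    (ae_of_all _ fun x => k.abs_apply_le hκ h x)

theorem integral_apply_sq_le (hk : Measurable fun p : 𝒳 × 𝒳 => k p.1 p.2) {κ : ℝ}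
    (hκ : ∀ x, k x x ≤ κ) (P : Measure 𝒳) [IsProbabilityMeasure P] (h : k.H) :
    ∫ x, h x ^ 2 ∂P ≤ κ * ‖h‖ ^ 2 := by
  have := integral_mono (μ := P) (k.memLp_coe hk hκ P h).integrable_sq
    (integrable_const (κ * ‖h‖ ^ 2)) fun x => k.apply_sq_le hκ h x
  simpa using this

end PosDefKernel

/-! ### Orthogonality of the regression residual. -/

/-- The residual `f - f₀(X)` is orthogonal to bounded measurable functions of `X`. -/
theorem IsRegressionFunction.integral_residual_mul {𝒳 : Type*} [MeasurableSpace 𝒳]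
    {ρ : Measure (𝒳 × ℝ)} [IsProbabilityMeasure ρ]
    (hf : Integrable (Prod.snd : 𝒳 × ℝ → ℝ) ρ) {f₀ : 𝒳 → ℝ} (hf₀ : IsRegressionFunction ρ f₀)
    {g : 𝒳 → ℝ} (hg : f₀ =ᵐ[ρ.fst] g) {h : 𝒳 → ℝ} (hh : Measurable h) {C : ℝ}
    (hC : ∀ x, ‖h x‖ ≤ C) :
    ∫ z, (z.2 - g z.1) * h z.1 ∂ρ = 0 := by
  have hle : MeasurableSpace.comap (Prod.fst : 𝒳 × ℝ → 𝒳) inferInstance ≤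
      Prod.instMeasurableSpace := measurable_fst.comap_le
  have hgρ : (fun z : 𝒳 × ℝ => g z.1) =ᵐ[ρ]
      ρ[Prod.snd | MeasurableSpace.comap Prod.fst inferInstance] :=
    (ae_eq_comp measurable_fst.aemeasurable hg).symm.trans hf₀.2
  have hhm : StronglyMeasurable[MeasurableSpace.comap (Prod.fst : 𝒳 × ℝ → 𝒳) inferInstance]
      (fun z : 𝒳 × ℝ => h z.1) :=
    (hh.comp (comap_measurable (Prod.fst : 𝒳 × ℝ → 𝒳))).stronglyMeasurable
  have hfh : Integrable (fun z : 𝒳 × ℝ => h z.1 * z.2) ρ :=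
    hf.bdd_mul (hh.comp measurable_fst).aestronglyMeasurable (ae_of_all _ fun z => hC z.1)
  have hgi : Integrable (fun z : 𝒳 × ℝ => g z.1) ρ := integrable_condExp.congr hgρ.symm
  have hgh : Integrable (fun z : 𝒳 × ℝ => h z.1 * g z.1) ρ :=
    hgi.bdd_mul (hh.comp measurable_fst).aestronglyMeasurable (ae_of_all _ fun z => hC z.1)
  have hpull := condExp_mul_of_stronglyMeasurable_left hhm hfh hf
  have heq : ∫ z, h z.1 * z.2 ∂ρ = ∫ z, h z.1 * g z.1 ∂ρ := by
    refine (integral_condExp hle).symm.trans (integral_congr_ae (hpull.trans ?_))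
    filter_upwards [hgρ] with z hz
    simp [hz]
  calc ∫ z, (z.2 - g z.1) * h z.1 ∂ρ = ∫ z, (h z.1 * z.2 - h z.1 * g z.1) ∂ρ := by
        congr 1; ext z; ring
    _ = 0 := by rw [integral_sub hfh hgh, heq, sub_self]

/-! ### Mean square error in `H_k`. -/

namespace PosDefKernel

/-- Mean square error bound of kernel ridge regression in the norm of `H_k`. -/
theorem exists_integral_norm_sub_estimator_sq_le {𝒳 : Type*} [MeasurableSpace 𝒳]
    (k : PosDefKernel 𝒳) (hk : Measurable fun p : 𝒳 × 𝒳 => k p.1 p.2) {κ : ℝ}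
    (hκ : ∀ x, k x x ≤ κ) (ρ : Measure (𝒳 × ℝ)) [IsProbabilityMeasure ρ]
    (hf : MemLp (Prod.snd : 𝒳 × ℝ → ℝ) 2 ρ) {f₀ : 𝒳 → ℝ} (hf₀ : IsRegressionFunction ρ f₀)
    (w g : k.H) (hg : ∀ h : k.H, inner ℝ g h = ∫ y, h y * w y ∂ρ.fst) (hfg : f₀ =ᵐ[ρ.fst] g) :
    ∃ A B : ℝ, ∀ (n : ℕ), 0 < n → ∀ lam : ℝ, 0 < lam →
        ∀ (Ω : Type v) [MeasurableSpace Ω] (μ : Measure Ω) [IsProbabilityMeasure μ]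
          (X : Fin n → Ω → 𝒳) (f : Fin n → Ω → ℝ), IsSample ρ μ X f →
          Integrable (fun ω => ‖g - k.estimator lam (fun i => X i ω) (fun i => f i ω)‖ ^ 2) μ ∧
          ∫ ω, ‖g - k.estimator lam (fun i => X i ω) (fun i => f i ω)‖ ^ 2 ∂μ
            ≤ A * lam ^ 2 + B / (lam ^ 2 * n) := by
  have hgm := k.measurable_coe hk g
  have hwm := k.measurable_coe hk w
  have hx1 : Measurable fun p : (𝒳 × ℝ) × (𝒳 × ℝ) => p.1.1 := measurable_fst.fst
  have hx2 : Measurable fun p : (𝒳 × ℝ) × (𝒳 × ℝ) => p.2.1 := measurable_snd.fst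
  have hkm : Measurable fun p : (𝒳 × ℝ) × (𝒳 × ℝ) => k p.1.1 p.2.1 := hk.comp (hx1.prodMk hx2)
  have hkd : ∀ z : 𝒳 × ℝ, ‖k z.1 z.1‖ ≤ κ := fun z => by
    rw [← norm_sec_sq, Real.norm_of_nonneg (by positivity), norm_sec_sq]
    exact hκ _
  have hkdm : AEStronglyMeasurable (fun z : 𝒳 × ℝ => k z.1 z.1) ρ :=
    (hk.comp (measurable_fst.prodMk measurable_fst)).aestronglyMeasurable
  have fst_int : ∀ {φ : 𝒳 → ℝ}, Measurable φ → ∫ z, φ z.1 ∂ρ = ∫ x, φ x ∂ρ.fst := fun hφ =>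
    (integral_map measurable_fst.aemeasurable hφ.aestronglyMeasurable).symm
  have fst_memLp : ∀ h : k.H, MemLp (fun z : 𝒳 × ℝ => h z.1) 2 ρ := fun h =>
    (k.memLp_coe hk hκ ρ.fst h).comp_of_map measurable_fst.aemeasurable
  -- the sampling noise
  let ψ : 𝒳 × ℝ → k.H := fun z => (z.2 - g z.1) • k.sec z.1
  have hψ_inner : ∀ z z', inner ℝ (ψ z) (ψ z') =
      (z.2 - g z.1) * ((z'.2 - g z'.1) * k.sec z.1 z'.1) := fun z z' => by
    simp only [ψ, inner_smul_left, inner_smul_right, inner_sec_sec, sec_apply, conj_trivial,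
      k.symm' z.1 z'.1]
    ring
  have hψ_meas : Measurable fun p : (𝒳 × ℝ) × (𝒳 × ℝ) => inner ℝ (ψ p.1) (ψ p.2) := by
    simp only [ψ, inner_smul_left, inner_smul_right, inner_sec_sec, conj_trivial]
    exact (measurable_snd.snd.sub (hgm.comp hx2)).mul
      ((measurable_fst.snd.sub (hgm.comp hx1)).mul hkm)
  have hψ_int : Integrable (fun z => ‖ψ z‖ ^ 2) ρ := by
    simp only [ψ, norm_smul, mul_pow, norm_sec_sq, Real.norm_eq_abs, sq_abs]
    exact (hf.sub (fst_memLp g)).integrable_sq.mul_bdd hkdm (ae_of_all _ hkd)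
  -- For fixed `z` this is a constant times the residual tested against the bounded function `k.sec
  -- z.1`.
  have hψ_cent : ∀ z, ∫ z', inner ℝ (ψ z) (ψ z') ∂ρ = 0 := fun z => by
    simp only [hψ_inner]
    rw [integral_const_mul, hf₀.integral_residual_mul (hf.integrable one_le_two) hfg
      (k.measurable_coe hk _) (k.abs_apply_le hκ _), mul_zero]
  -- the deviation of the empirical integral operator at `w`
  let φ : 𝒳 × ℝ → k.H := fun z => g - w z.1 • k.sec z.1
  have hφ_inner : ∀ (h : k.H) z, inner ℝ h (φ z) = inner ℝ g h - h z.1 * w z.1 := fun h z => by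
    rw [inner_sub_right, inner_smul_right, real_inner_comm g h, real_inner_comm (k.sec z.1) h,
      inner_sec, mul_comm]
  have hφ_meas : Measurable fun p : (𝒳 × ℝ) × (𝒳 × ℝ) => inner ℝ (φ p.1) (φ p.2) := by
    simp only [hφ_inner]
    simp only [φ, RKHS.coe_sub, RKHS.coe_smul, Pi.sub_apply, Pi.smul_apply, sec_apply,
      smul_eq_mul]
    have hkm' : Measurable fun p : (𝒳 × ℝ) × (𝒳 × ℝ) => k p.2.1 p.1.1 := hk.comp (hx2.prodMk hx1)
    exact (((hgm.comp hx1).mul (hwm.comp hx1)).const_sub _).sub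
      (((hgm.comp hx2).sub ((hwm.comp hx1).mul hkm')).mul (hwm.comp hx2))
  have hφ_int : Integrable (fun z => ‖φ z‖ ^ 2) ρ := by
    have hsq : Integrable (fun z : 𝒳 × ℝ => w z.1 ^ 2 * k z.1 z.1) ρ :=
      (fst_memLp w).integrable_sq.mul_bdd hkdm (ae_of_all _ hkd)
    refine (((integrable_const (‖g‖ ^ 2)).add hsq).const_mul 2).mono' ?_ (ae_of_all _ fun z => ?_)
    · simp only [← real_inner_self_eq_norm_sq]
      exact (hφ_meas.comp (measurable_id.prodMk measurable_id)).aestronglyMeasurable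
    · have h1 : w z.1 ^ 2 * k z.1 z.1 = ‖w z.1 • k.sec z.1‖ ^ 2 := by
        rw [norm_smul, mul_pow, norm_sec_sq, Real.norm_eq_abs, sq_abs]
      simp only [Pi.add_apply, h1, Real.norm_of_nonneg (sq_nonneg ‖φ z‖)]
      have h2 := norm_sub_le g (w z.1 • k.sec z.1)
      have h3 := norm_nonneg (g - w z.1 • k.sec z.1)
      change ‖g - w z.1 • k.sec z.1‖ ^ 2 ≤ _
      nlinarith [sq_nonneg (‖g‖ - ‖w z.1 • k.sec z.1‖)]
  -- This is the Riesz identity `hg` at `h = φ z`.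
  have hφ_cent : ∀ z, ∫ z', inner ℝ (φ z) (φ z') ∂ρ = 0 := fun z => by
    have hi : Integrable (fun z' : 𝒳 × ℝ => φ z z'.1 * w z'.1) ρ :=
      (fst_memLp _).integrable_mul (fst_memLp w)
    simp only [hφ_inner (φ z)]
    have hfst := fst_int ((k.measurable_coe hk (φ z)).mul hwm)
    simp only [Pi.mul_apply] at hfst
    rw [integral_sub (integrable_const _) hi, hg, hfst]
    simp
  set V₁ := ∫ z, ‖ψ z‖ ^ 2 ∂ρ with hV₁
  set V₂ := ∫ z, ‖φ z‖ ^ 2 ∂ρ with hV₂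
  have hV₂0 : 0 ≤ V₂ := integral_nonneg fun z => by positivity
  -- The factor 3 comes from `(a + b + c)² ≤ 3 (a² + b² + c²)`, and `12 = 3 · 2²`. `V₂` occurs in
  -- both constants because `V₂ / n` is split by `hcrude`.
  refine ⟨12 * ‖w‖ ^ 2 + 3 * V₂, 3 * (V₁ + V₂), fun n hn lam hlam Ω _ μ _ X f hS => ?_⟩
  obtain ⟨hindep, hlaw⟩ := hS
  have hn' : (0 : ℝ) < n := by positivity
  obtain ⟨hu_int, hu_eq⟩ := integral_norm_sq_average hψ_meas hψ_int hψ_cent hn hindep hlaw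
  obtain ⟨hv_int, hv_eq⟩ := integral_norm_sq_average hφ_meas hφ_int hφ_cent hn hindep hlaw
  set u : Ω → k.H := fun ω => (1 / (n : ℝ)) • ∑ i, ψ (X i ω, f i ω) with hu
  set v : Ω → k.H := fun ω => (1 / (n : ℝ)) • ∑ i, φ (X i ω, f i ω) with hv
  have hpt : ∀ ω, ‖g - k.estimator lam (fun i => X i ω) (fun i => f i ω)‖ ^ 2 ≤
      3 / lam ^ 2 * ‖u ω‖ ^ 2 + 3 * ‖v ω‖ ^ 2 + 12 * lam ^ 2 * ‖w‖ ^ 2 := by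
    intro ω
    have h := k.norm_sub_estimator_le hlam (fun i => X i ω) (fun i => f i ω) g w
    have hvω : g - (1 / (n : ℝ)) • ∑ i, w (X i ω) • k.sec (X i ω) = v ω := by
      simp only [hv, φ, Finset.sum_sub_distrib, smul_sub, Finset.sum_const, Finset.card_univ,
        Fintype.card_fin, ← Nat.cast_smul_eq_nsmul ℝ, smul_smul]
      rw [one_div_mul_cancel hn'.ne', one_smul]
    rw [hvω] at h
    change _ ≤ ‖u ω‖ / lam + ‖v ω‖ + 2 * lam * ‖w‖ at h
    calc _ ≤ (‖u ω‖ / lam + ‖v ω‖ + 2 * lam * ‖w‖) ^ 2 := by gcongr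
      _ ≤ 3 * ((‖u ω‖ / lam) ^ 2 + ‖v ω‖ ^ 2 + (2 * lam * ‖w‖) ^ 2) := by
        nlinarith [sq_nonneg (‖u ω‖ / lam - ‖v ω‖), sq_nonneg (‖u ω‖ / lam - 2 * lam * ‖w‖),
          sq_nonneg (‖v ω‖ - 2 * lam * ‖w‖)]
      _ = _ := by ring
  have hdom : Integrable (fun ω =>
      3 / lam ^ 2 * ‖u ω‖ ^ 2 + 3 * ‖v ω‖ ^ 2 + 12 * lam ^ 2 * ‖w‖ ^ 2) μ :=
    ((hu_int.const_mul _).add (hv_int.const_mul _)).add (integrable_const _)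
  have hint : Integrable
      (fun ω => ‖g - k.estimator lam (fun i => X i ω) (fun i => f i ω)‖ ^ 2) μ := by
    refine hdom.mono' ?_ (ae_of_all _ fun ω => ?_)
    · exact ((k.measurable_norm_sub_estimator_sq hk lam n g).comp_aemeasurable
        (aemeasurable_pi_lambda _ fun i => (hlaw i).aemeasurable)).aestronglyMeasurable
    · rw [Real.norm_of_nonneg (by positivity)]
      exact hpt ω
  refine ⟨hint, (integral_mono hint hdom hpt).trans ?_⟩
  rw [integral_add (f := fun ω => 3 / lam ^ 2 * ‖u ω‖ ^ 2 + 3 * ‖v ω‖ ^ 2)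
      ((hu_int.const_mul _).add (hv_int.const_mul _)) (integrable_const _),
    integral_add (hu_int.const_mul _) (hv_int.const_mul _), integral_const_mul,
    integral_const_mul, hu_eq, hv_eq, integral_const, ← hV₁, ← hV₂]
  -- The term `V₂ / n` carries no power of `lam`: it is absorbed by the second summand if `lam ≤ 1`
  -- and by the first if `lam ≥ 1`.
  have hcrude : 1 / (n : ℝ) ≤ lam ^ 2 + 1 / (lam ^ 2 * n) := by
    have h1 : 1 / (n : ℝ) ≤ 1 := by
      rw [div_le_one hn']; exact_mod_cast hn
    rcases le_total lam 1 with h | h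
    · have : 1 / (n : ℝ) ≤ 1 / (lam ^ 2 * n) := by
        apply one_div_le_one_div_of_le (by positivity)
        exact mul_le_of_le_one_left hn'.le (pow_le_one₀ hlam.le h)
      nlinarith [sq_nonneg lam]
    · have : 0 < 1 / (lam ^ 2 * n) := by positivity
      nlinarith
  have h3 := mul_le_mul_of_nonneg_left hcrude (mul_nonneg (by norm_num : (0 : ℝ) ≤ 3) hV₂0)
  simp only [probReal_univ, one_smul]
  calc _ = 3 * V₁ * (1 / (lam ^ 2 * n)) + 3 * V₂ * (1 / n) + 12 * lam ^ 2 * ‖w‖ ^ 2 := by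
        field_simp
    _ ≤ 3 * V₁ * (1 / (lam ^ 2 * n)) + 3 * V₂ * (lam ^ 2 + 1 / (lam ^ 2 * n)) +
        12 * lam ^ 2 * ‖w‖ ^ 2 := by linarith
    _ = _ := by ring

end PosDefKernel

/-! ### The two error bounds. -/

theorem theorem63 {𝒳 : Type u} [MeasurableSpace 𝒳] (k : PosDefKernel 𝒳)
    (hk_meas : Measurable fun p : 𝒳 × 𝒳 => k p.1 p.2)
    (hk_bdd : ∃ κ : ℝ, ∀ x y, |k x y| ≤ κ)
    (ρ : Measure (𝒳 × ℝ)) [IsProbabilityMeasure ρ]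
    (hf : MemLp (Prod.snd : 𝒳 × ℝ → ℝ) 2 ρ)
    (f₀ : 𝒳 → ℝ) (hf₀ : IsRegressionFunction ρ f₀)
    (w₀ : k.H) (hw₀ : f₀ =ᵐ[ρ.fst] k.integralOp ρ.fst w₀) :
    ∃ g : k.H, (∀ x, g x = k.integralOp ρ.fst w₀ x) ∧ f₀ =ᵐ[ρ.fst] g ∧
      (∃ C₀ C₁ C₂ : ℝ, ∀ (n : ℕ), 0 < n → ∀ lam : ℝ, 0 < lam →
        ∀ (Ω : Type v) [MeasurableSpace Ω] (μ : Measure Ω) [IsProbabilityMeasure μ]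
          (X : Fin n → Ω → 𝒳) (f : Fin n → Ω → ℝ),
          IsSample ρ μ X f →
          Integrable (fun ω => ‖g - k.estimator lam (fun i => X i ω) (fun i => f i ω)‖ ^ 2) μ ∧
          ∫ ω, ‖g - k.estimator lam (fun i => X i ω) (fun i => f i ω)‖ ^ 2 ∂μ
            ≤ 2 * C₀ * lam ^ 2 + 4 * C₁ / (lam ^ 2 * n) + C₂ / (lam ^ 3 * n)) ∧
      (∃ C₀ C₁ C₂ : ℝ, ∀ (n : ℕ), 0 < n → ∀ lam : ℝ, 0 < lam →
        ∀ (Ω : Type v) [MeasurableSpace Ω] (μ : Measure Ω) [IsProbabilityMeasure μ]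
          (X : Fin n → Ω → 𝒳) (f : Fin n → Ω → ℝ),
          IsSample ρ μ X f →
          (∀ ω, MemLp
            (fun x => f₀ x - k.estimator lam (fun i => X i ω) (fun i => f i ω) x) 2 ρ.fst) ∧
          Integrable (fun ω =>
            ∫ x, (f₀ x - k.estimator lam (fun i => X i ω) (fun i => f i ω) x) ^ 2 ∂ρ.fst) μ ∧
          ∫ ω, ∫ x, (f₀ x - k.estimator lam (fun i => X i ω) (fun i => f i ω) x) ^ 2 ∂ρ.fst ∂μ
            ≤ C₀ * lam ^ 2 + 4 * C₁ / (lam ^ 2 * n) + C₂ / (lam ^ 3 * n)) := by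
  obtain ⟨κ, hκ'⟩ := hk_bdd
  have hκ : ∀ x, k x x ≤ κ := fun x => (le_abs_self _).trans (hκ' x x)
  obtain ⟨z₀⟩ : Nonempty (𝒳 × ℝ) := nonempty_of_isProbabilityMeasure ρ
  have hκ0 : 0 ≤ κ := (abs_nonneg _).trans (hκ' z₀.1 z₀.1)
  obtain ⟨g, hg_inner, hg_apply⟩ := k.exists_integralOp_eq hk_meas hκ ρ.fst w₀
  have hfg : f₀ =ᵐ[ρ.fst] g := hw₀.trans (ae_of_all _ fun x => (hg_apply x).symm)
  obtain ⟨A, B, hAB⟩ := k.exists_integral_norm_sub_estimator_sq_le.{v} hk_meas hκ ρ hf hf₀ w₀ g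
    hg_inner hfg
  -- The divisors cancel the prefactors 2 and 4, and `κ` is the price of passing from `‖·‖_k` to
  -- `L²`.
  refine ⟨g, hg_apply, hfg, ⟨A / 2, B / 4, 0, ?_⟩, ⟨κ * A, κ * B / 4, 0, ?_⟩⟩
  · intro n hn lam hlam Ω _ μ _ X f hS
    obtain ⟨hint, hle⟩ := hAB n hn lam hlam Ω μ X f hS
    refine ⟨hint, hle.trans_eq ?_⟩
    ring
  · intro n hn lam hlam Ω _ μ _ X f hS
    obtain ⟨hint, hle⟩ := hAB n hn lam hlam Ω μ X f hS
    set e : Ω → k.H := fun ω => k.estimator lam (fun i => X i ω) (fun i => f i ω) with he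
    have hae : ∀ ω, (g - e ω : k.H) =ᵐ[ρ.fst] fun x => f₀ x - e ω x := fun ω => by
      filter_upwards [hfg] with x hx
      rw [RKHS.coe_sub, Pi.sub_apply, hx]
    have hle2 : ∀ ω, ∫ x, (f₀ x - e ω x) ^ 2 ∂ρ.fst ≤ κ * ‖g - e ω‖ ^ 2 := fun ω => by
      refine (integral_congr_ae ?_).trans_le
        (k.integral_apply_sq_le hk_meas hκ ρ.fst (g - e ω))
      filter_upwards [hae ω] with x hx
      rw [hx]
    have hint2 : Integrable (fun ω => ∫ x, (f₀ x - e ω x) ^ 2 ∂ρ.fst) μ := by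
      refine (hint.const_mul κ).mono' ?_ (ae_of_all _ fun ω => ?_)
      · have hm : Measurable fun p : (Fin n → 𝒳 × ℝ) × 𝒳 =>
            (f₀ p.2 - k.estimator lam (fun i => (p.1 i).1) (fun i => (p.1 i).2) p.2) ^ 2 :=
          ((hf₀.1.comp measurable_snd).sub
            (k.measurable_estimator_uncurry hk_meas lam n)).pow_const 2
        exact (hm.stronglyMeasurable.integral_prod_right' (ν := ρ.fst)).measurable.comp_aemeasurable
          (aemeasurable_pi_lambda _ fun i => (hS.2 i).aemeasurable) |>.aestronglyMeasurable
      · rw [Real.norm_of_nonneg (integral_nonneg fun x => sq_nonneg _)]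
        exact hle2 ω
    refine ⟨fun ω => (memLp_congr_ae (hae ω)).1 (k.memLp_coe hk_meas hκ ρ.fst _), hint2, ?_⟩
    refine (integral_mono hint2 (hint.const_mul κ) hle2).trans ?_
    rw [integral_const_mul]
    refine (mul_le_mul_of_nonneg_left hle hκ0).trans_eq ?_
    ring
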